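/- Write $e(z)=\exp(2\pi i z)$, and for positive integers $k,d,N$ let $$\mathfrak S_d^k(N)=\sum_{q=1}^{\infty}\ \sum_{\substack{1\le a\le q\\ \gcd(a,q)=1}} G_k(a/q)^d\, e(-Na/q),\qquad G_k(a/q)=\frac1q\sum_{r=1}^{q} e\!\left(\frac{a}{q}r^k\right),$$ be the singular series of Waring's problem for sums of $d$ positive $k$-th powers. For every integer $k\ge 2$ there exist constants $a_k,A_k>0$, depending only on $k$, such that for all integers $d\ge 2^k+1$ and all integers $N\ge 1$ the series over $q$ converges absolutely, its sum $\mathfrak S_d^k(N)$ is real, and $$a_k^d\le \mathfrak S_d^k(N)\le A_k .$$ -/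

import Mathlib

namespace Waring

/-- The additive character `e(z) = exp(2πiz)`. -/
noncomputable def e (z : ℂ) : ℂ := Complex.exp (2 * Real.pi * Complex.I * z)

/-- The normalized Gauss sum `G_k(a/q) = (1/q) ∑_{r=1}^q e((a/q) r^k)`. -/
noncomputable def gaussSum (k a q : ℕ) : ℂ :=
  (1 / (q : ℂ)) * ∑ r ∈ Finset.Icc 1 q, e ((a : ℂ) / (q : ℂ) * (r : ℂ) ^ k)

/-- The `q`-th term `∑_{1 ≤ a ≤ q, (a, q) = 1} G_k(a/q)^d e(-Na/q)` of the singular series. -/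
noncomputable def singularTerm (k d N q : ℕ) : ℂ :=
  ∑ a ∈ Finset.Icc 1 q with a.Coprime q,
    gaussSum k a q ^ d * e (-((N : ℂ) * (a : ℂ) / (q : ℂ)))

/-- The term at `q = 0` is an empty sum, so summing over all `q : ℕ` is the same as
summing over `q ≥ 1`. -/
theorem singularTerm_zero (k d N : ℕ) : singularTerm k d N 0 = 0 := by
  simp [singularTerm]

/-- The singular series `𝔖(N) = ∑_{q=1}^∞ ∑_{1 ≤ a ≤ q, (a, q) = 1} G_k(a/q)^d e(-Na/q)`. -/
noncomputable def singularSeries (k d N : ℕ) : ℂ := ∑' q : ℕ, singularTerm k d N q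

end Waring

namespace Waring
open Finset

/-! ### Complete exponential sums -/

/-! Everything rests on one estimate, uniform in d and N, and one identity. The estimate is
|G_k(a/q)| ≤ K q^(-σ) for each fixed σ < 1/k (`exists_norm_gaussSum_le`). It follows by
multiplicativity from prime powers, where units cancel once the exponent is large and k steps in the
exponent gain a factor 1/p, and from a second-moment bound of square-root size at primes. Since
|G_k| ≤ 1, only 2k+1 ≤ 2^k+1 ≤ d factors need be estimated, so the q-th term is O(q^(-s)) with s > 1
and a constant free of d and N. This gives convergence and the upper bound.

The identity is that the terms with q ∣ Q add up to Q^(1-d) times the number of solutions of the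
congruence mod Q (`sum_divisors_singularTerm`). This density is real and multiplicative in Q, and
along Q = n! it tends to the singular series, which is therefore real.

For the lower bound, densities at prime powers are treated in two ways. A solution with a unit
coordinate modulo a fixed power of p lifts, giving a density of at least c_p^d
(`exists_pow_le_density_prime_pow`). The term estimate also gives at least 1 - 2K p^(-s)
(`one_sub_le_density_prime_pow`). The first serves a finite set of primes independent of d and N;
over the rest the second gives a product of at least 1/2. -/

lemma e_intCast_div (q : ℕ) [NeZero q] (j : ℤ) : e ((j : ℂ) / q) = ZMod.stdAddChar (j : ZMod q) := by
  rw [ZMod.stdAddChar_coe, e, mul_div_assoc]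

lemma e_natCast_div (q : ℕ) [NeZero q] (j : ℕ) : e ((j : ℂ) / q) = ZMod.stdAddChar (j : ZMod q) := by
  simpa using e_intCast_div q (j : ℤ)

lemma sum_zmod_eq_sum_range {M : Type*} [AddCommMonoid M] (q : ℕ) [NeZero q] (f : ZMod q → M) :
    ∑ x : ZMod q, f x = ∑ i ∈ range q, f (i : ZMod q) := by
  symm
  refine sum_nbij' (fun i => (i : ZMod q)) ZMod.val (by simp) ?_ ?_ ?_ ?_
  · intro a _; simpa using ZMod.val_lt a
  · intro a ha; exact ZMod.val_cast_of_lt (by simpa using ha)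
  · intro a _; simp
  · intro a _; rfl

lemma sum_Icc_eq_sum_zmod {M : Type*} [AddCommMonoid M] (q : ℕ) [NeZero q] (f : ZMod q → M) :
    ∑ i ∈ Icc 1 q, f (i : ZMod q) = ∑ x : ZMod q, f x := by
  rw [← Equiv.sum_comp (Equiv.addRight (1 : ZMod q)) f, sum_zmod_eq_sum_range]
  have : Icc 1 q = Ico (0 + 1) (q + 1) := by ext; simp
  rw [this, ← sum_Ico_add' (fun i : ℕ => f (i : ZMod q)) 0 q 1, range_eq_Ico]
  simp

/-- The complete exponential sum `∑_{x mod q} e(u x^k / q)`. -/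
noncomputable def powSum (k q : ℕ) [NeZero q] (u : ZMod q) : ℂ :=
  ∑ x : ZMod q, ZMod.stdAddChar (u * x ^ k)

lemma gaussSum_eq (k a q : ℕ) [NeZero q] : gaussSum k a q = powSum k q a / q := by
  rw [gaussSum, powSum, one_div_mul_eq_div, ← sum_Icc_eq_sum_zmod]
  congr 1
  refine sum_congr rfl fun r _ => ?_
  have := e_natCast_div q (a * r ^ k)
  push_cast at this
  rw [← this]; congr 1; ring

lemma norm_powSum_le (k q : ℕ) [NeZero q] (u : ZMod q) : ‖powSum k q u‖ ≤ q := by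
  refine (norm_sum_le _ _).trans ?_
  simp [ZMod.card]

lemma norm_gaussSum_le_one (k a q : ℕ) : ‖gaussSum k a q‖ ≤ 1 := by
  rcases Nat.eq_zero_or_pos q with rfl | hq
  · simp [gaussSum]
  · have : NeZero q := ⟨hq.ne'⟩
    rw [gaussSum_eq, norm_div, Complex.norm_natCast]
    exact div_le_one_of_le₀ (norm_powSum_le k q _) (Nat.cast_nonneg _)

lemma sum_range_mul_of_periodic (f : ℕ → ℂ) (q : ℕ) (hf : Function.Periodic f q) (c : ℕ) :
    ∑ i ∈ range (c * q), f i = c * ∑ i ∈ range q, f i := by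
  induction c with
  | zero => simp
  | succ c ih =>
    rw [Nat.succ_mul, sum_range_add, ih]
    have : ∀ x, f (c * q + x) = f x := fun x => by
      rw [add_comm]; simpa using hf.nsmul c x
    simp only [this]; push_cast; ring

lemma gaussSum_eq_sum_range (k a q : ℕ) (hq : q ≠ 0) :
    gaussSum k a q = (∑ r ∈ range q, e (((a * r ^ k : ℕ) : ℂ) / q)) / q := by
  have : NeZero q := ⟨hq⟩
  rw [gaussSum_eq, powSum, sum_zmod_eq_sum_range]
  congr 1
  refine sum_congr rfl fun r _ => ?_
  rw [e_natCast_div]; push_cast; rfl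

lemma gaussSum_mul_mul (k a q c : ℕ) (hc : c ≠ 0) (hq : q ≠ 0) :
    gaussSum k (c * a) (c * q) = gaussSum k a q := by
  have : NeZero q := ⟨hq⟩
  have hc' : (c : ℂ) ≠ 0 := Nat.cast_ne_zero.2 hc
  have hq' : (q : ℂ) ≠ 0 := Nat.cast_ne_zero.2 hq
  rw [gaussSum_eq_sum_range k _ _ (mul_ne_zero hc hq), gaussSum_eq_sum_range k a q hq]
  have h1 : ∀ r : ℕ, (((c * a * r ^ k : ℕ) : ℂ) / (c * q : ℕ)) = ((a * r ^ k : ℕ) : ℂ) / q := by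
    intro r; push_cast; field_simp
  simp only [h1]
  rw [sum_range_mul_of_periodic]
  · push_cast; field_simp
  · intro r
    simp only [e_natCast_div]
    push_cast; simp

/-- Partial fractions: t/(mn) = st/m + rt/n. -/
lemma stdAddChar_crt (m n : ℕ) [NeZero m] [NeZero n] [NeZero (m * n)] (r s : ℤ)
    (h : r * m + s * n = 1) (t : ℤ) :
    (ZMod.stdAddChar (t : ZMod (m * n)) : ℂ) =
      ZMod.stdAddChar ((s * t : ℤ) : ZMod m) * ZMod.stdAddChar ((r * t : ℤ) : ZMod n) := by
  rw [ZMod.stdAddChar_coe, ZMod.stdAddChar_coe, ZMod.stdAddChar_coe, ← Complex.exp_add]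
  have hm : (m : ℂ) ≠ 0 := Nat.cast_ne_zero.2 (NeZero.ne m)
  have hn : (n : ℂ) ≠ 0 := Nat.cast_ne_zero.2 (NeZero.ne n)
  have h' : (r : ℂ) * m + s * n = 1 := by exact_mod_cast h
  congr 1
  push_cast
  field_simp
  linear_combination (-1 : ℂ) * t * h'

lemma powSum_crt (k m n : ℕ) [NeZero m] [NeZero n] [NeZero (m * n)] (hmn : m.Coprime n) (r s : ℤ)
    (h : r * m + s * n = 1) (a : ℤ) :
    powSum k (m * n) a = powSum k m (s * a : ℤ) * powSum k n (r * a : ℤ) := by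
  simp only [powSum]
  rw [sum_mul_sum, ← Fintype.sum_prod_type',
    ← Equiv.sum_comp (ZMod.chineseRemainder hmn).toEquiv]
  refine sum_congr rfl fun x _ => ?_
  obtain ⟨x, rfl⟩ := ZMod.intCast_surjective x
  have := stdAddChar_crt m n r s h (a * x ^ k)
  have h1 : (ZMod.chineseRemainder hmn).toEquiv (x : ZMod (m * n)) = ((x : ZMod m), (x : ZMod n)) := by
    change (ZMod.chineseRemainder hmn) (x : ZMod (m * n)) = _
    rw [map_intCast]; rfl
  rw [h1]
  push_cast at this ⊢
  rw [this]
  simp only [mul_assoc]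

lemma exists_gaussSum_mul (k m n a : ℕ) (hm : m ≠ 0) (hn : n ≠ 0) (hmn : m.Coprime n)
    (ha : a.Coprime (m * n)) :
    ∃ b c : ℕ, b.Coprime m ∧ c.Coprime n ∧
      gaussSum k a (m * n) = gaussSum k b m * gaussSum k c n := by
  have : NeZero m := ⟨hm⟩
  have : NeZero n := ⟨hn⟩
  have : NeZero (m * n) := ⟨mul_ne_zero hm hn⟩
  obtain ⟨r, s, h⟩ := (Nat.isCoprime_iff_coprime.2 hmn)
  have key := powSum_crt k m n hmn r s h a
  have hu : IsUnit ((s * a : ℤ) : ZMod m) := by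
    push_cast
    refine IsUnit.mul (IsUnit.of_mul_eq_one (n : ZMod m) ?_)
      ((ZMod.isUnit_iff_coprime _ _).2 ha.coprime_mul_right_right)
    have := congrArg (Int.cast : ℤ → ZMod m) h
    simpa using this
  have hv : IsUnit ((r * a : ℤ) : ZMod n) := by
    push_cast
    refine IsUnit.mul (IsUnit.of_mul_eq_one (m : ZMod n) ?_)
      ((ZMod.isUnit_iff_coprime _ _).2 ha.coprime_mul_left_right)
    have := congrArg (Int.cast : ℤ → ZMod n) h
    simpa using this
  refine ⟨((s * a : ℤ) : ZMod m).val, ((r * a : ℤ) : ZMod n).val, ?_, ?_, ?_⟩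
  · rw [← ZMod.isUnit_iff_coprime, ZMod.natCast_zmod_val]; exact hu
  · rw [← ZMod.isUnit_iff_coprime, ZMod.natCast_zmod_val]; exact hv
  · rw [gaussSum_eq, gaussSum_eq, gaussSum_eq, ZMod.natCast_zmod_val, ZMod.natCast_zmod_val]
    push_cast at key ⊢
    rw [key]; field_simp

/-! ### Gauss sums modulo prime powers -/

lemma sum_stdAddChar_mul_range_eq_zero {p q : ℕ} [NeZero q] (c : ZMod q) (hpc : p * c = 0)
    (hc : c ≠ 0) : ∑ w ∈ range p, (ZMod.stdAddChar (c * (w : ZMod q)) : ℂ) = 0 := by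
  have h1 : ∀ w : ℕ, (ZMod.stdAddChar (c * (w : ZMod q)) : ℂ) = ZMod.stdAddChar c ^ w := fun w => by
    rw [← AddChar.map_nsmul_eq_pow, nsmul_eq_mul, mul_comm]
  have h2 : (ZMod.stdAddChar c : ℂ) ≠ 1 := fun h => hc <|
    ZMod.injective_stdAddChar (h.trans (AddChar.map_zero_eq_one _).symm)
  simp only [h1]
  rw [geom_sum_eq h2, ← h1, mul_comm c, hpc, AddChar.map_zero_eq_one, sub_self, zero_div]

/-- Translation by p^(h-v-1) w permutes the units. Since 2(h-v-1) ≥ h, the k-th power is affine in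
w, and at a unit x its slope times a is divisible by p^(h-1) but not by p^h. Averaging over w mod p
thus sums a nontrivial character of order p. -/
lemma sum_stdAddChar_pow_eq_zero {p k v h a : ℕ} (hp : p.Prime) (hv : p ^ v ∣ k)
    (hv' : ¬ p ^ (v + 1) ∣ k) (hh : 2 * v + 2 ≤ h) (ha : ¬ p ∣ a) [NeZero (p ^ h)] :
    ∑ x : ZMod (p ^ h) with ¬ p ∣ x.val, (ZMod.stdAddChar ((a : ZMod (p ^ h)) * x ^ k) : ℂ) = 0 := by
  have hp0 : (p : ℂ) ≠ 0 := Nat.cast_ne_zero.2 hp.ne_zero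
  have hph : p ∣ p ^ h := dvd_pow_self p (by omega)
  have hval : ∀ x : ZMod (p ^ h), p ∣ x.val ↔ ZMod.castHom hph (ZMod p) x = 0 := fun x => by
    conv_rhs => rw [← ZMod.natCast_zmod_val x, map_natCast]
    exact (ZMod.natCast_eq_zero_iff _ _).symm
  set T := ∑ x : ZMod (p ^ h) with ¬ p ∣ x.val, (ZMod.stdAddChar ((a : ZMod (p ^ h)) * x ^ k) : ℂ) with hT
  set y : ZMod (p ^ h) := ((p ^ (h - v - 1) : ℕ) : ZMod (p ^ h)) with hy
  have hy2 : y ^ 2 = 0 := by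
    rw [hy, ← Nat.cast_pow, ZMod.natCast_eq_zero_iff, ← pow_mul]
    exact pow_dvd_pow p (by omega)
  have hy0 : ZMod.castHom hph (ZMod p) y = 0 := by
    rw [hy, map_natCast, ZMod.natCast_eq_zero_iff]
    exact dvd_pow_self p (by omega)
  have hpow : ∀ (x : ZMod (p ^ h)) (w : ℕ),
      (x + y * w) ^ k = x ^ k + k * x ^ (k - 1) * y * w := fun x w => by
    obtain ⟨z, hz⟩ := Polynomial.powAddExpansion x (y * w) k
    rw [hz, mul_pow, hy2]; ring
  have hshift : ∀ w : ℕ, T = ∑ x : ZMod (p ^ h) with ¬ p ∣ x.val,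
      (ZMod.stdAddChar ((a : ZMod (p ^ h)) * x ^ k) : ℂ) *
        ZMod.stdAddChar ((a : ZMod (p ^ h)) * ((k : ZMod (p ^ h)) * x ^ (k - 1) * y) * (w : ZMod (p ^ h))) := by
    intro w
    rw [hT]
    symm
    refine sum_equiv (Equiv.addRight (y * w)) ?_ ?_
    · intro x
      simp only [mem_filter, mem_univ, true_and, hval, Equiv.coe_addRight, map_add, map_mul, hy0,
        zero_mul, add_zero]
    · intro x _
      rw [← AddChar.map_add_eq_mul, Equiv.coe_addRight, hpow]
      congr 1; ring
  clear_value T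
  have hpT : (p : ℂ) * T = 0 := by
    calc (p : ℂ) * T = ∑ w ∈ range p, T := by simp
      _ = ∑ x : ZMod (p ^ h) with ¬ p ∣ x.val, (ZMod.stdAddChar ((a : ZMod (p ^ h)) * x ^ k) : ℂ) *
          ∑ w ∈ range p, (ZMod.stdAddChar ((a : ZMod (p ^ h)) *
             ((k : ZMod (p ^ h)) * x ^ (k - 1) * y) * (w : ZMod (p ^ h))) : ℂ) := by
        simp only [mul_sum]
        rw [sum_comm]
        exact sum_congr rfl fun w _ => hshift w
      _ = 0 := by
        refine sum_eq_zero fun x hx => ?_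
        rw [mem_filter] at hx
        obtain ⟨k', rfl⟩ := hv
        have hc : ((a : ZMod (p ^ h)) * (((p ^ v * k' : ℕ) : ZMod (p ^ h)) * x ^ (p ^ v * k' - 1) * y)) =
            ((p ^ (h - 1) * (a * k' * x.val ^ (p ^ v * k' - 1)) : ℕ) : ZMod (p ^ h)) := by
          have : p ^ (h - 1) = p ^ v * p ^ (h - v - 1) := by rw [← pow_add]; congr 1; omega
          rw [this, hy]; push_cast; rw [ZMod.natCast_zmod_val]; ring
        have hsucc : p ^ h = p ^ (h - 1) * p := by rw [← pow_succ]; congr 1; omega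
        rw [hc, sum_stdAddChar_mul_range_eq_zero, mul_zero]
        · rw [← Nat.cast_mul, ZMod.natCast_eq_zero_iff]
          have h1 := congrArg (· * (a * k' * x.val ^ (p ^ v * k' - 1))) hsucc
          exact ⟨a * k' * x.val ^ (p ^ v * k' - 1), by rw [h1]; ring⟩
        · rw [Ne, ZMod.natCast_eq_zero_iff]
          intro hd
          have hd' : p ^ (h - 1) * p ∣ p ^ (h - 1) * (a * k' * x.val ^ (p ^ v * k' - 1)) :=
            hsucc ▸ hd
          have := Nat.dvd_of_mul_dvd_mul_left (pow_pos hp.pos _) hd'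
          rcases (Nat.Prime.dvd_mul hp).1 this with h1 | h1
          · rcases (Nat.Prime.dvd_mul hp).1 h1 with h2 | h2
            · exact ha h2
            · exact hv' (by rw [pow_succ]; exact mul_dvd_mul_left _ h2)
          · exact hx.2 (hp.dvd_of_dvd_pow h1)
  exact (mul_eq_zero.1 hpT).resolve_left hp0

lemma gaussSum_prime_pow_succ {p k v h a : ℕ} (hp : p.Prime) (hk : k ≠ 0) (hv : p ^ v ∣ k)
    (hv' : ¬ p ^ (v + 1) ∣ k) (hh : 2 * v + 2 ≤ h) (ha : ¬ p ∣ a) :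
    gaussSum k a (p ^ h) = gaussSum k (a * p ^ (k - 1)) (p ^ (h - 1)) / p := by
  have hp0 : (p : ℂ) ≠ 0 := Nat.cast_ne_zero.2 hp.ne_zero
  have : NeZero (p ^ h) := ⟨(pow_pos hp.pos _).ne'⟩
  have hsucc : p ^ h = p * p ^ (h - 1) := by rw [← pow_succ']; congr 1; omega
  rw [gaussSum_eq, gaussSum_eq_sum_range _ _ _ (pow_pos hp.pos _).ne', powSum,
    ← sum_filter_add_sum_filter_not _ (fun x : ZMod (p ^ h) => p ∣ x.val),
    sum_stdAddChar_pow_eq_zero hp hv hv' hh ha, add_zero]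
  have : ∑ x : ZMod (p ^ h) with p ∣ x.val, (ZMod.stdAddChar ((a : ZMod (p ^ h)) * x ^ k) : ℂ) =
      ∑ r ∈ range (p ^ (h - 1)), e (((a * p ^ (k - 1) * r ^ k : ℕ) : ℂ) / (p ^ (h - 1) : ℕ)) := by
    symm
    refine sum_nbij' (fun r => ((p * r : ℕ) : ZMod (p ^ h))) (fun x => x.val / p) ?_ ?_ ?_ ?_ ?_
    · intro r hr
      have : p * r < p ^ h := by
        rw [hsucc]; exact Nat.mul_lt_mul_of_pos_left (mem_range.1 hr) hp.pos
      simp [-Nat.cast_mul, ZMod.val_cast_of_lt this]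
    · intro x hx
      rw [mem_range]
      exact Nat.div_lt_of_lt_mul (hsucc ▸ ZMod.val_lt x)
    · intro r hr
      have : p * r < p ^ h := by
        rw [hsucc]; exact Nat.mul_lt_mul_of_pos_left (mem_range.1 hr) hp.pos
      simp only [ZMod.val_cast_of_lt this, Nat.mul_div_cancel_left _ hp.pos]
    · intro x hx
      simp only [Nat.mul_div_cancel' (mem_filter.1 hx).2, ZMod.natCast_zmod_val]
    · intro r _
      have h1 : ((a * p ^ (k - 1) * r ^ k : ℕ) : ℂ) / (p ^ (h - 1) : ℕ) =
          ((a * (p * r) ^ k : ℕ) : ℂ) / (p ^ h : ℕ) := by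
        have h2 : p ^ k = p * p ^ (k - 1) := by rw [← pow_succ']; congr 1; omega
        rw [mul_pow, h2, hsucc]
        have h3 : (p : ℂ) ^ (h - 1) ≠ 0 := pow_ne_zero _ hp0
        push_cast; field_simp
      rw [h1, e_natCast_div]; push_cast; rfl
  rw [this, hsucc]
  have h3 : (p : ℂ) ^ (h - 1) ≠ 0 := pow_ne_zero _ hp0
  push_cast; field_simp

lemma norm_gaussSum_prime_pow_le_inv {p k v h a : ℕ} (hp : p.Prime) (hk : k ≠ 0) (hv : p ^ v ∣ k)
    (hv' : ¬ p ^ (v + 1) ∣ k) (hh : 2 * v + 2 ≤ h) (ha : ¬ p ∣ a) :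
    ‖gaussSum k a (p ^ h)‖ ≤ 1 / p := by
  rw [gaussSum_prime_pow_succ hp hk hv hv' hh ha, norm_div, Complex.norm_natCast]
  gcongr
  exact norm_gaussSum_le_one _ _ _

/-- After one reduction the fraction is a p^(k-1)/p^(h+k-1), which cancels to a/p^h. A factor 1/p
for every k steps is the source of the exponent 1/k. -/
lemma norm_gaussSum_prime_pow_add {p k v h a : ℕ} (hp : p.Prime) (hk : k ≠ 0) (hv : p ^ v ∣ k)
    (hv' : ¬ p ^ (v + 1) ∣ k) (hh : 2 * v + 2 ≤ h + k) (ha : ¬ p ∣ a) :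
    ‖gaussSum k a (p ^ (h + k))‖ = ‖gaussSum k a (p ^ h)‖ / p := by
  rw [gaussSum_prime_pow_succ hp hk hv hv' hh ha, norm_div, Complex.norm_natCast]
  have : p ^ (h + k - 1) = p ^ (k - 1) * p ^ h := by rw [← pow_add]; congr 1; omega
  rw [this, mul_comm a, gaussSum_mul_mul _ _ _ _ (pow_pos hp.pos _).ne' (pow_pos hp.pos _).ne']

/-! ### Gauss sums modulo primes -/

lemma card_filter_pow_eq_le {p k : ℕ} [Fact p.Prime] (hk : 0 < k) (c : ZMod p) :
    #{x : ZMod p | x ^ k = c} ≤ k := by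
  classical
  have : ({x : ZMod p | x ^ k = c} : Finset (ZMod p)) = (Polynomial.nthRoots k c).toFinset := by
    ext x; simp [Polynomial.mem_nthRoots hk]
  rw [this]
  exact (Multiset.toFinset_card_le _).trans (Polynomial.card_nthRoots k c)

lemma sum_normSq_powSum {p k : ℕ} [Fact p.Prime] :
    ∑ u : ZMod p, ‖powSum k p u‖ ^ 2 =
      p * #{xy : ZMod p × ZMod p | xy.1 ^ k = xy.2 ^ k} := by
  have h1 : ∀ u : ZMod p, ((‖powSum k p u‖ ^ 2 : ℝ) : ℂ) =
      ∑ xy : ZMod p × ZMod p, (ZMod.stdAddChar (u * (xy.1 ^ k - xy.2 ^ k)) : ℂ) := by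
    intro u
    rw [Fintype.sum_prod_type]
    push_cast
    rw [← Complex.mul_conj', powSum, map_sum, sum_mul_sum]
    refine sum_congr rfl fun x _ => sum_congr rfl fun y _ => ?_
    rw [mul_sub, sub_eq_add_neg, AddChar.map_add_eq_mul, AddChar.map_neg_eq_conj]
  have h2 : ((∑ u : ZMod p, ‖powSum k p u‖ ^ 2 : ℝ) : ℂ) =
      ((p * #{xy : ZMod p × ZMod p | xy.1 ^ k = xy.2 ^ k} : ℝ) : ℂ) := by
    rw [Complex.ofReal_sum]
    simp only [h1]
    rw [sum_comm]
    simp only [AddChar.sum_mulShift _ (ZMod.isPrimitive_stdAddChar p), sub_eq_zero, ZMod.card]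
    simp [sum_ite, mul_comm]
  exact_mod_cast h2

lemma card_pow_eq_pow_le {p k : ℕ} [Fact p.Prime] (hk : 0 < k) :
    #{xy : ZMod p × ZMod p | xy.1 ^ k = xy.2 ^ k} ≤ p * k := by
  have h : ∀ y ∈ (univ : Finset (ZMod p)),
      #{xy ∈ ({xy : ZMod p × ZMod p | xy.1 ^ k = xy.2 ^ k} : Finset _) | xy.2 = y} ≤ k := by
    intro y _
    refine le_trans ?_ (card_filter_pow_eq_le hk (y ^ k))
    refine card_le_card_of_injOn Prod.fst ?_ ?_
    · rintro ⟨x, z⟩ hx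
      simp only [coe_filter, mem_filter, mem_univ, true_and, Set.mem_ofPred_eq] at hx ⊢
      rw [hx.1, hx.2]
    · rintro ⟨x, z⟩ hx ⟨x', z'⟩ hx' hxx
      simp only [coe_filter, mem_filter, mem_univ, true_and, Set.mem_ofPred_eq] at hx hx' hxx
      rw [hxx, hx.2, hx'.2]
  have := card_le_mul_card_image_of_maps_to (f := Prod.snd) (t := (univ : Finset (ZMod p)))
    (s := ({xy : ZMod p × ZMod p | xy.1 ^ k = xy.2 ^ k} : Finset _)) (fun _ _ => mem_univ _) k h
  simpa [mul_comm, ZMod.card] using this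

lemma powSum_mul_pow {p k : ℕ} [Fact p.Prime] (u t : ZMod p) (ht : t ≠ 0) :
    powSum k p (u * t ^ k) = powSum k p u := by
  rw [powSum, powSum, ← Equiv.sum_comp (Equiv.mulLeft₀ t ht)
    (fun x => (ZMod.stdAddChar (u * x ^ k) : ℂ))]
  refine sum_congr rfl fun x _ => ?_
  simp [mul_pow, mul_assoc]

/-- The sum is unchanged when u is multiplied by a nonzero k-th power, and each b equals u t^k for
at most k values of t. Hence (p-1)|S(u)|² is at most k times the second moment, so at most k²p², and
p ≤ 2(p-1). -/
lemma normSq_powSum_prime_le {p k : ℕ} [Fact p.Prime] (hk : 0 < k) (u : ZMod p) (hu : u ≠ 0) :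
    ‖powSum k p u‖ ^ 2 ≤ 2 * k ^ 2 * p := by
  have hp : p.Prime := Fact.out
  have h1 : ((p : ℝ) - 1) * ‖powSum k p u‖ ^ 2 =
      ∑ t : ZMod p with t ≠ 0, ‖powSum k p (u * t ^ k)‖ ^ 2 := by
    rw [sum_congr rfl (g := fun _ => ‖powSum k p u‖ ^ 2)
      (fun t ht => by rw [powSum_mul_pow u t (mem_filter.1 ht).2])]
    rw [sum_const, nsmul_eq_mul, filter_ne' univ (0 : ZMod p), card_erase_of_mem (mem_univ _),
      card_univ, ZMod.card, Nat.cast_sub hp.one_le, Nat.cast_one]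
  have h2 : ∑ t : ZMod p with t ≠ 0, ‖powSum k p (u * t ^ k)‖ ^ 2 ≤
      k * ∑ b : ZMod p, ‖powSum k p b‖ ^ 2 := by
    calc ∑ t : ZMod p with t ≠ 0, ‖powSum k p (u * t ^ k)‖ ^ 2
        ≤ ∑ t : ZMod p, ‖powSum k p (u * t ^ k)‖ ^ 2 :=
          sum_le_sum_of_subset_of_nonneg (filter_subset _ _) fun _ _ _ => by positivity
      _ = ∑ b : ZMod p, ∑ t : ZMod p with u * t ^ k = b, ‖powSum k p (u * t ^ k)‖ ^ 2 :=
          (sum_fiberwise _ _ _).symm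
      _ = ∑ b : ZMod p, #{t : ZMod p | u * t ^ k = b} * ‖powSum k p b‖ ^ 2 := by
          refine sum_congr rfl fun b _ => ?_
          rw [sum_congr rfl (g := fun _ => ‖powSum k p b‖ ^ 2)
            (fun t ht => by rw [(mem_filter.1 ht).2]), sum_const, nsmul_eq_mul]
      _ ≤ ∑ b : ZMod p, k * ‖powSum k p b‖ ^ 2 := by
          gcongr with b _
          have : univ.filter (fun t : ZMod p => u * t ^ k = b) =
              univ.filter (fun t : ZMod p => t ^ k = u⁻¹ * b) := by
            ext t; simp [eq_inv_mul_iff_mul_eq₀ hu]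
          rw [this]
          exact card_filter_pow_eq_le hk _
      _ = _ := by rw [mul_sum]
  rw [← h1, sum_normSq_powSum] at h2
  have h3 : ((#{xy : ZMod p × ZMod p | xy.1 ^ k = xy.2 ^ k} : ℕ) : ℝ) ≤ p * k := by
    exact_mod_cast card_pow_eq_pow_le hk
  have h4 : (2 : ℝ) ≤ p := by exact_mod_cast hp.two_le
  have h5 : ((p : ℝ) - 1) * ‖powSum k p u‖ ^ 2 ≤ k * (p * (p * k)) := h2.trans (by gcongr)
  have h6 : (0 : ℝ) ≤ k ^ 2 * p := by positivity
  have h7 : ((p : ℝ) - 1) * ‖powSum k p u‖ ^ 2 ≤ (p - 1) * (2 * k ^ 2 * p) := by nlinarith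
  exact le_of_mul_le_mul_left h7 (by linarith)

lemma norm_gaussSum_prime_le {p k a : ℕ} (hp : p.Prime) (hk : 0 < k) (ha : ¬ p ∣ a) :
    ‖gaussSum k a p‖ ≤ 2 * k * (p : ℝ) ^ (-(1 / 2) : ℝ) := by
  have : Fact p.Prime := ⟨hp⟩
  have h := normSq_powSum_prime_le hk (a : ZMod p) (by rwa [Ne, ZMod.natCast_eq_zero_iff])
  have hp0 : (0 : ℝ) < p := by exact_mod_cast hp.pos
  rw [gaussSum_eq, norm_div, Complex.norm_natCast, Real.rpow_neg hp0.le, ← Real.sqrt_eq_rpow,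
    ← div_eq_mul_inv, div_le_div_iff₀ hp0 (Real.sqrt_pos.2 hp0)]
  have hs := Real.sq_sqrt hp0.le
  refine abs_le_of_sq_le_sq' ?_ (by positivity) |>.2
  rw [mul_pow, hs]
  have : (0 : ℝ) ≤ k ^ 2 * p ^ 2 := by positivity
  nlinarith

/-! ### Bounds for Gauss sums and for the terms of the singular series -/

lemma rpow_pow_add_neg_inv {p k : ℕ} (hp : 0 < p) (hk : 0 < k) (h : ℕ) :
    ((p : ℝ) ^ (h + k)) ^ (-(1 / k) : ℝ) = ((p : ℝ) ^ h) ^ (-(1 / k) : ℝ) / p := by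
  have hp' : (0 : ℝ) < p := by exact_mod_cast hp
  have hk' : (k : ℝ) ≠ 0 := by exact_mod_cast hk.ne'
  rw [pow_add, Real.mul_rpow (by positivity) (by positivity),
    div_eq_mul_inv _ (p : ℝ)]
  congr 1
  rw [← Real.rpow_natCast (p : ℝ) k, ← Real.rpow_mul hp'.le, mul_neg, mul_one_div_cancel hk',
    Real.rpow_neg_one]

lemma norm_gaussSum_prime_pow_le {p k : ℕ} (hp : p.Prime) (hk : 2 ≤ k) (a h : ℕ) (ha : ¬ p ∣ a) :
    ‖gaussSum k a (p ^ h)‖ ≤ (k : ℝ) ^ (2 * k + 2) * ((p : ℝ) ^ h) ^ (-(1 / k) : ℝ) := by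
  have hk1 : (1 : ℝ) ≤ k := by exact_mod_cast (by omega : 1 ≤ k)
  have hk2 : (2 : ℝ) ≤ k := by exact_mod_cast hk
  have hp1 : (1 : ℝ) ≤ p := by exact_mod_cast hp.one_le
  have hp0 : (0 : ℝ) < p := by linarith
  have hC : (1 : ℝ) ≤ (k : ℝ) ^ (2 * k + 2) := one_le_pow₀ hk1
  have hk0 : k ≠ 0 := by omega
  have hinv : (1 / k : ℝ) ≤ 1 := by rw [div_le_one (by linarith)]; exact hk1
  have hinv0 : (0 : ℝ) ≤ 1 / k := by positivity
  obtain ⟨v, hv, hv'⟩ : ∃ v, p ^ v ∣ k ∧ ¬ p ^ (v + 1) ∣ k :=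
    ⟨k.factorization p, Nat.ordProj_dvd k p, Nat.pow_succ_factorization_not_dvd hk0 hp⟩
  have hvk : v < k := (Nat.lt_pow_self hp.one_lt).trans_le (Nat.le_of_dvd (by omega) hv)
  induction h using Nat.strong_induction_on with
  | _ h ih =>
  have step : k ≤ h → 2 * v + 2 ≤ h → ‖gaussSum k a (p ^ h)‖ ≤
      (k : ℝ) ^ (2 * k + 2) * ((p : ℝ) ^ h) ^ (-(1 / k) : ℝ) := by
    intro h1 h2
    obtain ⟨h', rfl⟩ := Nat.exists_eq_add_of_le' h1
    rw [norm_gaussSum_prime_pow_add hp hk0 hv hv' h2 ha, rpow_pow_add_neg_inv hp.pos (by omega),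
      ← mul_div_assoc]
    gcongr
    exact ih h' (by omega)
  by_cases hpk : p ∣ k
  -- As v < k, the reduction by k steps applies from h = 2k+2 on; below that p^h ≤ k^(2k+2) makes
  -- the trivial bound enough.
  · by_cases hh : 2 * k + 2 ≤ h
    · exact step (by omega) (by omega)
    · refine (norm_gaussSum_le_one _ _ _).trans ?_
      rw [Real.rpow_neg (by positivity), ← div_eq_mul_inv, one_le_div (by positivity)]
      calc ((p : ℝ) ^ h) ^ (1 / k : ℝ) ≤ ((p : ℝ) ^ h) ^ (1 : ℝ) :=
            Real.rpow_le_rpow_of_exponent_le (one_le_pow₀ hp1) hinv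
        _ = (p : ℝ) ^ h := Real.rpow_one _
        _ ≤ (k : ℝ) ^ h := by
            gcongr; exact_mod_cast Nat.le_of_dvd (by omega) hpk
        _ ≤ _ := pow_le_pow_right₀ hk1 (by omega)
  · have hv0 : v = 0 := by
      by_contra h0
      exact hpk ((dvd_pow_self p h0).trans hv)
    subst hv0
    rcases Nat.lt_or_ge h 2 with h2 | h2
    · interval_cases h
      · simpa using (norm_gaussSum_le_one k a _).trans hC
      · rw [pow_one, pow_one]
        refine (norm_gaussSum_prime_le hp (by omega) ha).trans ?_
        gcongr
        · calc (2 : ℝ) * k ≤ k ^ 2 := by nlinarith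
            _ ≤ _ := pow_le_pow_right₀ hk1 (by omega)
    · rcases le_total k h with h3 | h3
      · exact step h3 (by omega)
      · refine (norm_gaussSum_prime_pow_le_inv hp hk0 hv hv' (by omega) ha).trans ?_
        have h4 := rpow_pow_add_neg_inv hp.pos (by omega : 0 < k) 0
        rw [zero_add, pow_zero, Real.one_rpow] at h4
        rw [← h4]
        refine le_trans ?_ (le_mul_of_one_le_left (by positivity) hC)
        exact Real.rpow_le_rpow_of_nonpos (by positivity) (pow_le_pow_right₀ hp1 h3) (by linarith)

/-- Multiplying prime-power bounds would cost C for each prime factor of q, which is unbounded.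
Giving up 1/k - σ in the exponent absorbs C at every p ≥ P, so only the primes below P are charged.
-/
lemma norm_gaussSum_le_pow_mul {k P : ℕ} (hk : 2 ≤ k) {C σ : ℝ} (hC : (k : ℝ) ^ (2 * k + 2) ≤ C)
    (hσ : σ < 1 / k) (hP : ∀ p : ℕ, P ≤ p → C ≤ (p : ℝ) ^ (1 / k - σ)) (q : ℕ) :
    ∀ a : ℕ, a.Coprime q →
      ‖gaussSum k a q‖ ≤ C ^ #{p ∈ q.primeFactors | p < P} * (q : ℝ) ^ (-σ) := by
  have hC1 : 1 ≤ C :=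
    (one_le_pow₀ (by exact_mod_cast (by omega : 1 ≤ k))).trans hC
  induction q using Nat.recOnPosPrimePosCoprime with
  | zero => intro a _; simp [gaussSum]; positivity
  | one => intro a _; simpa using norm_gaussSum_le_one k a 1
  | prime_pow p n hp hn =>
    intro a ha
    have hp1 : (1 : ℝ) ≤ p := by exact_mod_cast hp.one_le
    have hq1 : (1 : ℝ) ≤ (p : ℝ) ^ n := one_le_pow₀ hp1
    have ha' : ¬ p ∣ a := fun h =>
      hp.one_lt.ne' (Nat.dvd_one.1 (ha ▸ Nat.dvd_gcd h (dvd_pow_self p hn.ne')))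
    have h1 : ‖gaussSum k a (p ^ n)‖ ≤ C * ((p : ℝ) ^ n) ^ (-(1 / k) : ℝ) :=
      (norm_gaussSum_prime_pow_le hp hk a n ha').trans (by gcongr)
    rw [Nat.primeFactors_prime_pow hn.ne' hp, filter_singleton]
    push_cast
    split_ifs with hpP
    · rw [card_singleton, pow_one]
      exact h1.trans (by gcongr)
    · rw [card_empty, pow_zero, one_mul]
      refine h1.trans ?_
      have h2 : C ≤ ((p : ℝ) ^ n) ^ (1 / k - σ) := (hP p (not_lt.1 hpP)).trans <|
        Real.rpow_le_rpow (by linarith) (le_self_pow₀ hp1 hn.ne') (by linarith)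
      calc C * ((p : ℝ) ^ n) ^ (-(1 / k) : ℝ)
          ≤ ((p : ℝ) ^ n) ^ (1 / k - σ) * ((p : ℝ) ^ n) ^ (-(1 / k) : ℝ) := by gcongr
        _ = _ := by rw [← Real.rpow_add (by linarith)]; congr 1; ring
  | coprime m n hm hn hmn ihm ihn =>
    intro a ha
    obtain ⟨b, c, hb, hc, h⟩ := exists_gaussSum_mul k m n a (by omega) (by omega) hmn ha
    rw [h, norm_mul, hmn.primeFactors_mul, filter_union, card_union_of_disjoint, pow_add]
    · push_cast
      rw [Real.mul_rpow (by positivity) (by positivity)]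
      calc _ ≤ _ := mul_le_mul (ihm b hb) (ihn c hc) (norm_nonneg _) (by positivity)
        _ = _ := by ring
    · exact disjoint_filter_filter hmn.disjoint_primeFactors

lemma exists_norm_gaussSum_le {k : ℕ} (hk : 2 ≤ k) {σ : ℝ} (hσ : σ < 1 / k) :
    ∃ K : ℝ, 1 ≤ K ∧ ∀ a q : ℕ, a.Coprime q → ‖gaussSum k a q‖ ≤ K * (q : ℝ) ^ (-σ) := by
  set C : ℝ := (k : ℝ) ^ (2 * k + 2)
  have hC1 : 1 ≤ C := one_le_pow₀ (by exact_mod_cast (by omega : 1 ≤ k))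
  have ht := (tendsto_rpow_atTop (by linarith : 0 < 1 / (k : ℝ) - σ)).comp
    (tendsto_natCast_atTop_atTop (R := ℝ))
  obtain ⟨P, hP⟩ := Filter.eventually_atTop.1 (ht.eventually_ge_atTop C)
  refine ⟨C ^ P, one_le_pow₀ hC1, fun a q ha => ?_⟩
  refine (norm_gaussSum_le_pow_mul hk le_rfl hσ hP q a ha).trans ?_
  gcongr
  calc #{p ∈ q.primeFactors | p < P} ≤ #(range P) :=
      card_le_card fun p hp => mem_range.2 (mem_filter.1 hp).2
    _ = P := card_range P

lemma exists_norm_singularTerm_le {k : ℕ} (hk : 2 ≤ k) :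
    ∃ K s : ℝ, 0 < K ∧ 1 < s ∧ ∀ d : ℕ, 2 ^ k + 1 ≤ d → ∀ N q : ℕ,
      ‖singularTerm k d N q‖ ≤ K * (q : ℝ) ^ (-s) := by
  have hk0 : (0 : ℝ) < k := by exact_mod_cast (by omega : 0 < k)
  -- Any σ strictly between 2/(2k+1) and 1/k would do: then (2k+1)σ - 1 > 1.
  set σ : ℝ := 4 / (4 * k + 1) with hσdef
  have hσ : σ < 1 / k := by
    rw [hσdef, div_lt_div_iff₀ (by positivity) hk0]; linarith
  obtain ⟨K, hK, hG⟩ := exists_norm_gaussSum_le hk hσ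
  have h2k : 2 * k ≤ 2 ^ k := by
    obtain ⟨m, rfl⟩ := Nat.exists_eq_add_of_le' (by omega : 1 ≤ k)
    have := Nat.lt_two_pow_self (n := m)
    rw [pow_succ]; omega
  refine ⟨K ^ (2 * k + 1), (2 * k + 1) * σ - 1, by positivity, ?_, ?_⟩
  · have : 1 < (2 * k + 1) * σ - 1 ↔ 2 < (2 * k + 1) * 4 / (4 * (k : ℝ) + 1) := by
      rw [hσdef, mul_div_assoc]; constructor <;> intro h <;> linarith
    rw [this, lt_div_iff₀ (by positivity)]
    linarith
  · intro d hd N q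
    rcases Nat.eq_zero_or_pos q with rfl | hq
    · rw [singularTerm_zero, norm_zero]; positivity
    have hq0 : (0 : ℝ) < q := by exact_mod_cast hq
    have hterm : ∀ a ∈ {a ∈ Icc 1 q | a.Coprime q},
        ‖gaussSum k a q ^ d * e (-((N : ℂ) * (a : ℂ) / (q : ℂ)))‖ ≤
          K ^ (2 * k + 1) * (q : ℝ) ^ (-((2 * k + 1) * σ)) := by
      intro a ha
      have he : ‖e (-((N : ℂ) * (a : ℂ) / (q : ℂ)))‖ = 1 := by
        have : 2 * (Real.pi : ℂ) * Complex.I * (-((N : ℂ) * (a : ℂ) / (q : ℂ))) =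
            ((2 * Real.pi * (-(N * a / q)) : ℝ) : ℂ) * Complex.I := by push_cast; ring
        rw [e, this, Complex.norm_exp_ofReal_mul_I]
      rw [norm_mul, norm_pow, he, mul_one]
      -- Lowering the exponent from d to 2k+1 keeps the constants independent of d.
      calc ‖gaussSum k a q‖ ^ d ≤ ‖gaussSum k a q‖ ^ (2 * k + 1) :=
            pow_le_pow_of_le_one (norm_nonneg _) (norm_gaussSum_le_one _ _ _) (by omega)
        _ ≤ (K * (q : ℝ) ^ (-σ)) ^ (2 * k + 1) := by
            gcongr; exact hG a q (mem_filter.1 ha).2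
        _ = _ := by
            rw [mul_pow, ← Real.rpow_natCast ((q : ℝ) ^ (-σ)), ← Real.rpow_mul hq0.le]
            congr 2; push_cast; ring
    calc ‖singularTerm k d N q‖
        ≤ #{a ∈ Icc 1 q | a.Coprime q} • (K ^ (2 * k + 1) * (q : ℝ) ^ (-((2 * k + 1) * σ))) :=
          (norm_sum_le _ _).trans (sum_le_card_nsmul _ _ _ hterm)
      _ ≤ q * (K ^ (2 * k + 1) * (q : ℝ) ^ (-((2 * k + 1) * σ))) := by
          rw [nsmul_eq_mul]
          gcongr
          simpa using card_filter_le (Icc 1 q) (fun a => a.Coprime q)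
      _ = _ := by
          rw [neg_sub, Real.rpow_sub hq0, Real.rpow_one, Real.rpow_neg hq0.le]
          field_simp

/-! ### Partial sums of the singular series count congruence solutions -/

/-- The number of solutions of `x₁^k + ⋯ + x_d^k = N` modulo `q`. -/
noncomputable def numSol (k d N q : ℕ) [NeZero q] : ℕ :=
  #{x : Fin d → ZMod q | ∑ i, x i ^ k = (N : ZMod q)}

/-- The bijection is reduction of b/Q to lowest terms; `hf` says that f depends only on the
fraction. -/
lemma sum_divisors_sum_coprime {M : Type*} [AddCommMonoid M] (f : ℕ → ℕ → M)
    (hf : ∀ c a q, c ≠ 0 → q ≠ 0 → f (c * a) (c * q) = f a q) (Q : ℕ) (hQ : Q ≠ 0) :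
    ∑ q ∈ Q.divisors, ∑ a ∈ Icc 1 q with a.Coprime q, f a q = ∑ b ∈ Icc 1 Q, f b Q := by
  rw [sum_sigma']
  refine sum_bij' (fun x _ => Q / x.1 * x.2) (fun b _ => ⟨Q / b.gcd Q, b / b.gcd Q⟩) ?_ ?_ ?_ ?_ ?_
  · rintro ⟨q, a⟩ h
    simp only [mem_sigma, Nat.mem_divisors, mem_filter, mem_Icc] at h ⊢
    obtain ⟨⟨⟨c, rfl⟩, -⟩, ⟨h1, h2⟩, -⟩ := h
    obtain ⟨hq, hc⟩ := mul_ne_zero_iff.1 hQ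
    rw [Nat.mul_div_cancel_left _ (by omega)]
    exact ⟨Nat.mul_pos (by omega) h1, by rw [mul_comm q]; exact Nat.mul_le_mul_left _ h2⟩
  · intro b hb
    simp only [mem_sigma, Nat.mem_divisors, mem_filter, mem_Icc] at hb ⊢
    have hg : 0 < b.gcd Q := Nat.gcd_pos_of_pos_left _ (by omega)
    refine ⟨⟨Nat.div_dvd_of_dvd (Nat.gcd_dvd_right _ _), hQ⟩, ⟨?_, ?_⟩, ?_⟩
    · exact Nat.div_pos (Nat.le_of_dvd (by omega) (Nat.gcd_dvd_left _ _)) hg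
    · exact Nat.div_le_div_right hb.2
    · exact Nat.coprime_div_gcd_div_gcd hg
  · rintro ⟨q, a⟩ h
    simp only [mem_sigma, Nat.mem_divisors, mem_filter, mem_Icc] at h
    obtain ⟨⟨⟨c, rfl⟩, -⟩, ⟨h1, h2⟩, h3⟩ := h
    obtain ⟨hq, hc⟩ := mul_ne_zero_iff.1 hQ
    have h4 : (c * a).gcd (q * c) = c := by rw [mul_comm q, Nat.gcd_mul_left, h3, mul_one]
    simp only [Nat.mul_div_cancel_left _ (by omega : 0 < q), h4,
      Nat.mul_div_cancel _ (by omega : 0 < c), Nat.mul_div_cancel_left _ (by omega : 0 < c)]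
  · intro b hb
    simp only [mem_Icc] at hb
    have hg : 0 < b.gcd Q := Nat.gcd_pos_of_pos_left _ (by omega)
    simp only [Nat.div_div_self (Nat.gcd_dvd_right b Q) hQ, Nat.mul_div_cancel' (Nat.gcd_dvd_left b Q)]
  · rintro ⟨q, a⟩ h
    simp only [mem_sigma, Nat.mem_divisors, mem_filter, mem_Icc] at h
    obtain ⟨⟨⟨c, rfl⟩, -⟩, -, -⟩ := h
    obtain ⟨hq, hc⟩ := mul_ne_zero_iff.1 hQ
    simp only [Nat.mul_div_cancel_left _ (by omega : 0 < q)]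
    rw [mul_comm q, hf _ _ _ hc hq]

lemma addChar_map_sum {A M ι : Type*} [AddCommMonoid A] [CommMonoid M] (ψ : AddChar A M)
    (s : Finset ι) (f : ι → A) : ψ (∑ i ∈ s, f i) = ∏ i ∈ s, ψ (f i) := by
  classical
  induction s using Finset.induction_on with
  | empty => simp
  | insert i s hi ih => rw [sum_insert hi, prod_insert hi, AddChar.map_add_eq_mul, ih]

lemma sum_powSum_pow (k d N q : ℕ) [NeZero q] :
    ∑ u : ZMod q, powSum k q u ^ d * ZMod.stdAddChar (-((N : ZMod q) * u)) = q * numSol k d N q := by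
  have h1 : ∀ u : ZMod q, powSum k q u ^ d * ZMod.stdAddChar (-((N : ZMod q) * u)) =
      ∑ x : Fin d → ZMod q, (ZMod.stdAddChar (u * (∑ i, x i ^ k - (N : ZMod q))) : ℂ) := by
    intro u
    rw [powSum, Fintype.sum_pow, sum_mul]
    refine sum_congr rfl fun x _ => ?_
    rw [← addChar_map_sum, ← AddChar.map_add_eq_mul, ← mul_sum]
    congr 1; ring
  simp only [h1]
  rw [sum_comm]
  simp only [AddChar.sum_mulShift _ (ZMod.isPrimitive_stdAddChar q), sub_eq_zero, ZMod.card]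
  simp [sum_ite, mul_comm, numSol]

lemma sum_divisors_singularTerm (k d N Q : ℕ) [NeZero Q] :
    ∑ q ∈ Q.divisors, singularTerm k d N q = ((Q * numSol k d N Q / (Q : ℝ) ^ d : ℝ) : ℂ) := by
  simp only [singularTerm]
  rw [sum_divisors_sum_coprime
    (fun a q => gaussSum k a q ^ d * e (-((N : ℂ) * (a : ℂ) / (q : ℂ)))) _ Q (NeZero.ne Q)]
  · have h1 : ∀ b : ℕ, gaussSum k b Q ^ d * e (-((N : ℂ) * (b : ℂ) / (Q : ℂ))) =
        (powSum k Q b ^ d * ZMod.stdAddChar (-((N : ZMod Q) * (b : ZMod Q)))) / (Q : ℂ) ^ d := by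
      intro b
      have h2 := e_intCast_div Q (-(N * b))
      push_cast at h2
      rw [gaussSum_eq, ← neg_div, h2, div_pow, div_mul_eq_mul_div]
    simp only [h1]
    rw [← sum_div, sum_Icc_eq_sum_zmod Q
      (fun u => powSum k Q u ^ d * (ZMod.stdAddChar (-((N : ZMod Q) * u)) : ℂ)), sum_powSum_pow]
    push_cast; rfl
  · intro c a q hc hq
    have hc' : (c : ℂ) ≠ 0 := Nat.cast_ne_zero.2 hc
    have hq' : (q : ℂ) ≠ 0 := Nat.cast_ne_zero.2 hq
    rw [gaussSum_mul_mul k a q c hc hq]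
    congr 3; push_cast; field_simp

lemma numSol_mul (k d N m n : ℕ) [NeZero m] [NeZero n] [NeZero (m * n)] (hmn : m.Coprime n) :
    numSol k d N (m * n) = numSol k d N m * numSol k d N n := by
  classical
  rw [numSol, numSol, numSol, ← card_product]
  set φ := ZMod.chineseRemainder hmn
  refine card_nbij' (fun x => (fun i => (φ (x i)).1, fun i => (φ (x i)).2))
    (fun y i => φ.symm (y.1 i, y.2 i)) ?_ ?_ ?_ ?_
  · intro x hx
    simp only [coe_filter, mem_univ, true_and, Set.mem_ofPred_eq, coe_product, Set.mem_prod] at hx ⊢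
    have := congrArg φ hx
    rw [map_sum, map_natCast] at this
    simp only [map_pow] at this
    exact ⟨by simpa [Prod.fst_sum] using congrArg Prod.fst this,
      by simpa [Prod.snd_sum] using congrArg Prod.snd this⟩
  · rintro ⟨y, z⟩ h
    simp only [coe_filter, mem_univ, true_and, Set.mem_ofPred_eq, coe_product, Set.mem_prod] at h ⊢
    apply φ.injective
    rw [map_sum, map_natCast]
    simp only [map_pow, RingEquiv.apply_symm_apply]
    ext
    · simpa [Prod.fst_sum] using h.1
    · simpa [Prod.snd_sum] using h.2
  · intro x _; simp
  · rintro ⟨y, z⟩ _; simp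

/-- The normalized number of solutions modulo `q`, set to `1` for the junk modulus `0`. -/
noncomputable def density (k d N q : ℕ) : ℝ :=
  if h : q = 0 then 1 else have : NeZero q := ⟨h⟩; q * numSol k d N q / (q : ℝ) ^ d

lemma density_eq (k d N q : ℕ) [NeZero q] :
    density k d N q = q * numSol k d N q / (q : ℝ) ^ d := by
  rw [density, dif_neg (NeZero.ne q)]

lemma sum_divisors_singularTerm_eq_density (k d N Q : ℕ) (hQ : Q ≠ 0) :
    ∑ q ∈ Q.divisors, singularTerm k d N q = (density k d N Q : ℂ) := by
  have : NeZero Q := ⟨hQ⟩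
  rw [sum_divisors_singularTerm, density_eq]

lemma density_one (k d N : ℕ) : density k d N 1 = 1 := by
  rw [density_eq, numSol]
  simp [Subsingleton.elim (_ : ZMod 1) (N : ZMod 1)]

lemma density_mul (k d N m n : ℕ) (hmn : m.Coprime n) :
    density k d N (m * n) = density k d N m * density k d N n := by
  rcases Nat.eq_zero_or_pos m with rfl | hm
  · obtain rfl : n = 1 := by simpa using hmn
    simp [density_one]
  rcases Nat.eq_zero_or_pos n with rfl | hn
  · obtain rfl : m = 1 := by simpa using hmn
    simp [density_one]
  have : NeZero m := ⟨hm.ne'⟩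
  have : NeZero n := ⟨hn.ne'⟩
  have : NeZero (m * n) := ⟨(Nat.mul_pos hm hn).ne'⟩
  rw [density_eq, density_eq, density_eq, numSol_mul k d N m n hmn]
  push_cast
  rw [mul_pow]; field_simp

lemma density_eq_prod (k d N Q : ℕ) (hQ : Q ≠ 0) :
    density k d N Q = ∏ p ∈ Q.primeFactors, density k d N (p ^ Q.factorization p) :=
  Nat.multiplicative_factorization (density k d N) (fun m n => density_mul k d N m n)
    (density_one k d N) hQ

/-! ### Lifting `k`-th power residues -/

/-- Hensel lifting by counting: t ↦ ((y + p^j t)^k - m)/p^(j+v) is injective mod p^r by `H`, hence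
surjective, hence takes the value 0. -/
lemma exists_pow_lift {p k j v : ℕ} (hp : p.Prime) (hj : j ≠ 0)
    (H : ∀ x y : ℤ, (p : ℤ) ^ j ∣ x - y → ¬ (p : ℤ) ∣ x →
      ∀ n : ℕ, (p : ℤ) ^ (n + v) ∣ x ^ k - y ^ k → (p : ℤ) ^ n ∣ x - y)
    (H' : ∀ x y : ℤ, (p : ℤ) ^ j ∣ x - y → ¬ (p : ℤ) ∣ x → (p : ℤ) ^ (j + v) ∣ x ^ k - y ^ k)
    (n : ℕ) (y m : ℤ) (hy : ¬ (p : ℤ) ∣ y) (hym : (p : ℤ) ^ (j + v) ∣ y ^ k - m) :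
    ∃ x : ℤ, (p : ℤ) ^ n ∣ x ^ k - m := by
  rcases le_total n (j + v) with hn | hn
  · exact ⟨y, (pow_dvd_pow _ hn).trans hym⟩
  obtain ⟨r, rfl⟩ := Nat.exists_eq_add_of_le hn
  have hp0 : (p : ℤ) ≠ 0 := by exact_mod_cast hp.ne_zero
  have : NeZero (p ^ r) := ⟨(pow_pos hp.pos _).ne'⟩
  have hndvd : ∀ t : ℤ, ¬ (p : ℤ) ∣ y + p ^ j * t := fun t h =>
    hy ((dvd_add_left (Dvd.dvd.mul_right (dvd_pow_self _ hj) t)).1 h)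
  have hf : ∀ t : ℤ, ∃ f : ℤ, (y + p ^ j * t) ^ k - m = p ^ (j + v) * f := fun t => by
    have h1 := H' (y + p ^ j * t) y (by simp) (hndvd t)
    have h2 := dvd_add h1 hym
    rwa [sub_add_sub_cancel] at h2
  choose f hf using hf
  have hinj : Function.Injective (fun t : ZMod (p ^ r) => (f t.val : ZMod (p ^ r))) := by
    intro t t' h
    have h1 : ((p ^ r : ℕ) : ℤ) ∣ f t.val - f t'.val := by
      rw [← ZMod.intCast_zmod_eq_zero_iff_dvd, Int.cast_sub, sub_eq_zero]; exact h
    have h2 := H (y + p ^ j * t.val) (y + p ^ j * t'.val) (by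
      rw [add_sub_add_left_eq_sub, ← mul_sub]; exact dvd_mul_right _ _) (hndvd _) (r + j) (by
      rw [← sub_sub_sub_cancel_right _ _ m, hf, hf, ← mul_sub, add_assoc, pow_add, mul_comm]
      push_cast at h1
      exact mul_dvd_mul_left _ h1)
    rw [add_sub_add_left_eq_sub, ← mul_sub, add_comm r, pow_add] at h2
    have h3 := (mul_dvd_mul_iff_left (pow_ne_zero j hp0)).1 h2
    have h4 : ((p ^ r : ℕ) : ℤ) ∣ (t.val : ℤ) - t'.val := by push_cast; exact h3
    rw [← ZMod.intCast_zmod_eq_zero_iff_dvd, Int.cast_sub, sub_eq_zero] at h4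
    simpa using h4
  obtain ⟨t, ht⟩ := Finite.injective_iff_surjective.1 hinj 0
  refine ⟨y + p ^ j * t.val, ?_⟩
  rw [hf, pow_add]
  have h5 := (ZMod.intCast_zmod_eq_zero_iff_dvd _ _).1 ht
  push_cast at h5
  exact mul_dvd_mul_left _ h5

/-- Congruences modulo `p ^ γ` with a unit `k`-th power lift to all powers of `p`. -/
def LiftsFrom (p k γ : ℕ) : Prop :=
  ∀ (n : ℕ) (y m : ℤ), ¬ (p : ℤ) ∣ y → (p : ℤ) ^ γ ∣ y ^ k - m →
    ∃ x : ℤ, (p : ℤ) ^ n ∣ x ^ k - m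

lemma liftsFrom_of_emultiplicity {p k j v : ℕ} (hp : p.Prime) (hj : j ≠ 0)
    (H : ∀ x y : ℤ, (p : ℤ) ^ j ∣ x - y → ¬ (p : ℤ) ∣ x →
      emultiplicity (p : ℤ) (x ^ k - y ^ k) = emultiplicity (p : ℤ) (x - y) + v) :
    LiftsFrom p k (j + v) := by
  refine exists_pow_lift hp hj (fun x y h1 h2 n h3 => ?_) (fun x y h1 h2 => ?_)
  · rw [pow_dvd_iff_le_emultiplicity, H x y h1 h2, Nat.cast_add] at h3
    rw [pow_dvd_iff_le_emultiplicity]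
    exact (ENat.add_le_add_iff_right (ENat.natCast_ne_top v)).1 h3
  · rw [pow_dvd_iff_le_emultiplicity] at h1 ⊢
    rw [H x y (pow_dvd_iff_le_emultiplicity.2 h1) h2, Nat.cast_add]
    gcongr

lemma liftsFrom_of_not_dvd {p k : ℕ} (hp : p.Prime) (hk : ¬ p ∣ k) : LiftsFrom p k 1 :=
  liftsFrom_of_emultiplicity (v := 0) hp one_ne_zero fun x y h1 h2 => by
    rw [emultiplicity_pow_sub_pow_of_prime (Nat.prime_iff_prime_int.1 hp) (by simpa using h1) h2
      (by exact_mod_cast hk)]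
    simp

lemma liftsFrom_of_odd {p k v : ℕ} (hp : p.Prime) (hodd : Odd p) (hv : p ^ v ∣ k)
    (hv' : ¬ p ^ (v + 1) ∣ k) : LiftsFrom p k (1 + v) :=
  liftsFrom_of_emultiplicity hp one_ne_zero fun x y h1 h2 => by
    rw [Int.emultiplicity_pow_sub_pow hp hodd (by simpa using h1) h2,
      emultiplicity_eq_coe.2 ⟨hv, hv'⟩]

/-- Lifting the exponent at 2 involves x + y as well. Congruence mod 4 of odd x and y makes x + y
exactly divisible by 2, whence the level j = 2. -/
lemma liftsFrom_two {k v : ℕ} (hk : Even k) (hv : 2 ^ v ∣ k) (hv' : ¬ 2 ^ (v + 1) ∣ k) :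
    LiftsFrom 2 k (2 + v) :=
  liftsFrom_of_emultiplicity Nat.prime_two two_ne_zero fun x y h1 h2 => by
    push_cast at h1 h2 ⊢
    have h3 := Int.two_pow_sub_pow ((dvd_pow_self 2 two_ne_zero).trans h1) h2 hk
    have h4 : emultiplicity (2 : ℤ) (x + y) = (1 : ℕ) :=
      emultiplicity_eq_coe.2 ⟨by omega, by omega⟩
    have h5 : emultiplicity (2 : ℤ) (k : ℤ) = v :=
      emultiplicity_eq_coe.2 ⟨by exact_mod_cast hv, by exact_mod_cast hv'⟩
    rw [h4, h5, Nat.cast_one, add_assoc, add_comm 1] at h3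
    exact (WithTop.add_right_inj ENat.one_ne_top).1 h3

/-! ### Primitive solutions modulo small prime powers -/

/-- `∑ xᵢ^k = N` has a solution modulo `p ^ γ` with some `xᵢ` prime to `p`. -/
def HasPrimitiveSol (p k γ d N : ℕ) : Prop :=
  ∃ (z : Fin d → ℤ) (i : Fin d), ¬ (p : ℤ) ∣ z i ∧ (p : ℤ) ^ γ ∣ ∑ i, z i ^ k - N

/-- The range starts at 1 so that N, written as a sum of n ones, always has a unit coordinate. -/
lemma exists_mem_Icc_dvd_sub (q N : ℕ) (hq : 0 < q) :
    ∃ n : ℕ, 1 ≤ n ∧ n ≤ q ∧ (q : ℤ) ∣ n - N := by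
  refine ⟨(N + (q - 1)) % q + 1, by omega, Nat.mod_lt _ hq, ?_⟩
  have h := Nat.div_add_mod (N + (q - 1)) q
  refine ⟨1 - ((N + (q - 1)) / q : ℕ), ?_⟩
  have h' : (q : ℤ) * ((N + (q - 1)) / q : ℕ) + ((N + (q - 1)) % q : ℕ) = N + (q - 1) := by
    have := congrArg (Nat.cast : ℕ → ℤ) h
    push_cast [Nat.cast_sub (show 1 ≤ q from hq)] at this ⊢
    exact this
  push_cast at h' ⊢
  linarith

lemma sum_indicator_pow {k d n : ℕ} (hk : k ≠ 0) (hn : n ≤ d) :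
    ∑ i : Fin d, (if (i : ℕ) < n then (1 : ℤ) else 0) ^ k = n := by
  have h1 : ∀ i : Fin d, (if (i : ℕ) < n then (1 : ℤ) else 0) ^ k =
      if (i : ℕ) < n then 1 else 0 := fun i => by split_ifs <;> simp [hk]
  simp only [h1]
  rw [Fin.sum_univ_eq_sum_range (fun i => if i < n then (1 : ℤ) else 0) d, sum_ite]
  have : filter (fun i => i < n) (range d) = range n := by ext; simp; omega
  simp [this]

lemma hasPrimitiveSol_of_le {p k γ d N : ℕ} (hp : p.Prime) (hk : k ≠ 0) (hd : p ^ γ ≤ d) :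
    HasPrimitiveSol p k γ d N := by
  obtain ⟨n, hn1, hn, h⟩ := exists_mem_Icc_dvd_sub (p ^ γ) N (pow_pos hp.pos _)
  refine ⟨fun i => if (i : ℕ) < n then 1 else 0, ⟨0, by omega⟩, ?_, ?_⟩
  · simp only [if_pos (show 0 < n from hn1)]
    exact_mod_cast hp.one_lt.ne' ∘ Nat.dvd_one.1
  · rw [sum_indicator_pow hk (hn.trans hd)]
    exact_mod_cast h

/-- Five variables are fewer than the modulus 8. For residues 6, 7, 8 one variable equal to 2
contributes 4, leaving at most four ones. -/
lemma hasPrimitiveSol_two_two {d N : ℕ} (hd : 5 ≤ d) : HasPrimitiveSol 2 2 3 d N := by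
  obtain ⟨n, hn1, hn, h⟩ := exists_mem_Icc_dvd_sub (2 ^ 3) N (by norm_num)
  obtain ⟨d, rfl⟩ := Nat.exists_eq_add_of_le' (show 1 ≤ d by omega)
  rcases le_or_gt n 5 with h5 | h5
  · refine ⟨fun i => if (i : ℕ) < n then 1 else 0, 0, ?_, ?_⟩
    · have h0 : 0 < n := hn1
      norm_num [h0]
    · rw [sum_indicator_pow two_ne_zero (by omega)]
      exact_mod_cast h
  · refine ⟨Fin.cons 2 fun i => if (i : ℕ) < n - 4 then 1 else 0, Fin.succ ⟨0, by omega⟩, ?_, ?_⟩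
    · rw [Fin.cons_succ, if_pos (show 0 < n - 4 by omega)]; norm_num
    · rw [Fin.sum_univ_succ]
      simp only [Fin.cons_zero, Fin.cons_succ]
      rw [sum_indicator_pow two_ne_zero (by omega)]
      push_cast [Nat.cast_sub (show 4 ≤ n by omega)] at h ⊢
      rw [show (4 : ℤ) + (n - 4) - N = n - N by ring]
      exact h

lemma le_mul_card_image_pow {p k : ℕ} [Fact p.Prime] (hk : 0 < k) :
    p - 1 ≤ k * (#(univ.image fun x : ZMod p => x ^ k) - 1) := by
  have h0 : (0 : ZMod p) ∈ univ.image fun x : ZMod p => x ^ k :=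
    mem_image.2 ⟨0, mem_univ _, zero_pow hk.ne'⟩
  have := card_le_mul_card_image_of_maps_to (f := fun x : ZMod p => x ^ k)
    (s := univ.erase (0 : ZMod p)) (t := (univ.image fun x : ZMod p => x ^ k).erase 0) (by
      intro x hx
      rw [mem_erase] at hx ⊢
      exact ⟨pow_ne_zero _ hx.1, mem_image_of_mem _ hx.2⟩) k (fun b _ =>
      (card_le_card (filter_subset_filter _ (erase_subset _ _))).trans (card_filter_pow_eq_le hk b))
  rwa [card_erase_of_mem (mem_univ _), card_erase_of_mem h0, card_univ, ZMod.card] at this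

open scoped Pointwise in
-- Cauchy–Davenport, iterated over the number of summands.
lemma min_le_card_image_sum_pow {p k : ℕ} [Fact p.Prime] (s : ℕ) :
    min p (s * (#(univ.image fun x : ZMod p => x ^ k) - 1) + 1) ≤
      #(univ.image fun z : Fin s → ZMod p => ∑ i, z i ^ k) := by
  have hp : p.Prime := Fact.out
  set A := univ.image fun x : ZMod p => x ^ k with hA
  have hA0 : A.Nonempty := univ_nonempty.image _
  induction s with
  | zero => simp
  | succ s ih =>
    set B := univ.image fun z : Fin s → ZMod p => ∑ i, z i ^ k with hB
    have hB0 : B.Nonempty := univ_nonempty.image _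
    have hsub : A + B ⊆ univ.image fun z : Fin (s + 1) → ZMod p => ∑ i, z i ^ k := by
      intro c hc
      obtain ⟨a, ha, b, hb, rfl⟩ := mem_add.1 hc
      obtain ⟨x, -, rfl⟩ := mem_image.1 ha
      obtain ⟨z, -, rfl⟩ := mem_image.1 hb
      exact mem_image.2 ⟨Fin.cons x z, mem_univ _, by simp [Fin.sum_univ_succ]⟩
    have h1 := ZMod.cauchy_davenport hp hA0 hB0
    have h2 := card_le_card hsub
    have h3 := hA0.card_pos
    have h4 : (s + 1) * (#A - 1) = s * (#A - 1) + (#A - 1) := by ring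
    rw [h4]
    omega

lemma exists_sum_pow_eq {p k s : ℕ} [Fact p.Prime] (hk : 0 < k) (hs : k ≤ s) (c : ZMod p) :
    ∃ z : Fin s → ZMod p, ∑ i, z i ^ k = c := by
  have h1 := min_le_card_image_sum_pow (p := p) (k := k) s
  have h2 := le_mul_card_image_pow (p := p) hk
  have h3 := Nat.mul_le_mul_right (#(univ.image fun x : ZMod p => x ^ k) - 1) hs
  have h4 : (univ.image fun z : Fin s → ZMod p => ∑ i, z i ^ k) = univ := by
    rw [← card_eq_iff_eq_univ, ZMod.card]
    refine le_antisymm ((card_le_univ _).trans_eq (ZMod.card p)) ?_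
    omega
  have h5 := mem_univ c
  rw [← h4] at h5
  simpa using h5

lemma hasPrimitiveSol_of_lt {p k d N : ℕ} (hp : p.Prime) (hk : 0 < k) (hd : k < d) :
    HasPrimitiveSol p k 1 d N := by
  have : Fact p.Prime := ⟨hp⟩
  obtain ⟨d, rfl⟩ := Nat.exists_eq_add_of_le' (show 1 ≤ d by omega)
  obtain ⟨z, hz⟩ := exists_sum_pow_eq (p := p) (s := d) hk (by omega) ((N : ZMod p) - 1)
  refine ⟨Fin.cons 1 fun i => ((z i).val : ℤ), 0, ?_, ?_⟩
  · rw [Fin.cons_zero]; exact_mod_cast hp.one_lt.ne' ∘ Nat.dvd_one.1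
  · rw [pow_one, ← ZMod.intCast_zmod_eq_zero_iff_dvd, Fin.sum_univ_succ]
    simp [hz]

lemma sq_le_two_pow_add_one {k : ℕ} (hk : 3 ≤ k) : k ^ 2 ≤ 2 ^ k + 1 := by
  rcases eq_or_lt_of_le hk with rfl | hk
  · norm_num
  · refine Nat.le_succ_of_le ?_
    obtain ⟨m, rfl⟩ := Nat.exists_eq_add_of_le' (show 4 ≤ k from hk)
    clear hk
    induction m with
    | zero => norm_num
    | succ m ih => rw [add_right_comm, pow_succ 2]; nlinarith [ih (by omega)]

/-- If p ∤ k, then γ = 1 and k+1 variables suffice. If p ∣ k and k ≥ 3, then p^γ ≤ k² ≤ 2^k+1, so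
zeros and ones suffice. Only k = p = 2 needs a separate argument. -/
lemma exists_liftsFrom_and_hasPrimitiveSol {p k : ℕ} (hp : p.Prime) (hk : 2 ≤ k) :
    ∃ γ, LiftsFrom p k γ ∧ ∀ d, 2 ^ k + 1 ≤ d → ∀ N, HasPrimitiveSol p k γ d N := by
  have hk2 := Nat.lt_two_pow_self (n := k)
  by_cases hpk : p ∣ k
  · obtain ⟨v, hv, hv'⟩ : ∃ v, p ^ v ∣ k ∧ ¬ p ^ (v + 1) ∣ k :=
      ⟨k.factorization p, Nat.ordProj_dvd k p, Nat.pow_succ_factorization_not_dvd (by omega) hp⟩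
    have hvk := Nat.le_of_dvd (by omega) hv
    have hpk' := Nat.le_of_dvd (by omega) hpk
    rcases hp.eq_two_or_odd' with rfl | hodd
    · refine ⟨2 + v, liftsFrom_two (even_iff_two_dvd.2 hpk) hv hv', fun d hd N => ?_⟩
      rcases eq_or_lt_of_le hk with rfl | hk'
      · obtain rfl : v = 1 := by
          have h1 : v < 2 := (Nat.pow_le_pow_iff_right (a := 2) (by norm_num) (m := 1)).1 hvk
            |>.trans_lt (by norm_num)
          interval_cases v
          · norm_num at hv'
          · rfl
        exact hasPrimitiveSol_two_two hd
      · refine hasPrimitiveSol_of_le hp (by omega) ?_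
        have h4 : 4 ≤ k := by omega
        have := sq_le_two_pow_add_one hk'
        calc 2 ^ (2 + v) = 4 * 2 ^ v := by rw [pow_add]; norm_num
          _ ≤ k * k := Nat.mul_le_mul h4 hvk
          _ ≤ d := by nlinarith
    · refine ⟨1 + v, liftsFrom_of_odd hp hodd hv hv', fun d hd N => ?_⟩
      refine hasPrimitiveSol_of_le hp (by omega) ?_
      have h3 : 3 ≤ p := by
        rcases hodd with ⟨m, rfl⟩
        have := hp.two_le
        omega
      have := sq_le_two_pow_add_one (h3.trans hpk')
      calc p ^ (1 + v) = p * p ^ v := by rw [pow_add, pow_one]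
        _ ≤ k * k := Nat.mul_le_mul hpk' hvk
        _ ≤ d := by nlinarith
  · exact ⟨1, liftsFrom_of_not_dvd hp hpk, fun d hd N =>
      hasPrimitiveSol_of_lt hp (by omega) (by omega)⟩

/-! ### Lower bounds for the densities -/

/-- All coordinates but the unit one move freely in their classes mod p^γ; lifting then solves for
the remaining one. -/
lemma pow_le_numSol {p k γ d N : ℕ} (hp : p.Prime) (hlift : LiftsFrom p k γ)
    (hsol : HasPrimitiveSol p k γ d N) (n : ℕ) [NeZero (p ^ n)] :
    p ^ ((n - γ) * (d - 1)) ≤ numSol k d N (p ^ n) := by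
  obtain ⟨z, i, hzi, hz⟩ := hsol
  obtain ⟨d, rfl⟩ := Nat.exists_eq_add_of_le' (show 1 ≤ d from Fin.pos i)
  have hp0 : (p : ℤ) ≠ 0 := by exact_mod_cast hp.ne_zero
  have : NeZero (p ^ (n - γ)) := ⟨(pow_pos hp.pos _).ne'⟩
  let y : (Fin d → ZMod (p ^ (n - γ))) → Fin d → ℤ :=
    fun w l => z (i.succAbove l) + p ^ γ * (w l).val
  have hx : ∀ w, ∃ x : ℤ, (p : ℤ) ^ n ∣ x ^ k - (N - ∑ l, y w l ^ k) := by
    intro w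
    refine hlift n (z i) _ hzi ?_
    have h1 : (p : ℤ) ^ γ ∣ ∑ l, y w l ^ k - ∑ l, z (i.succAbove l) ^ k := by
      rw [← sum_sub_distrib]
      refine dvd_sum fun l _ => ?_
      refine Dvd.dvd.trans ?_ (sub_dvd_pow_sub_pow _ _ k)
      simp [y]
    rw [Fin.sum_univ_succAbove _ i] at hz
    have h2 := dvd_add hz h1
    have h3 : z i ^ k - (N - ∑ l, y w l ^ k) = z i ^ k + ∑ l, z (i.succAbove l) ^ k - N +
        (∑ l, y w l ^ k - ∑ l, z (i.succAbove l) ^ k) := by ring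
    rw [h3]
    exact h2
  choose x hx using hx
  have hcard : Fintype.card (Fin d → ZMod (p ^ (n - γ))) = p ^ ((n - γ) * (d + 1 - 1)) := by
    simp [ZMod.card, pow_mul]
  rw [← hcard, ← card_univ, numSol]
  refine card_le_card_of_injOn
    (fun w => i.insertNth (x w : ZMod (p ^ n)) fun l => (y w l : ZMod (p ^ n))) ?_ ?_
  · intro w _
    simp only [coe_filter, mem_univ, true_and, Set.mem_ofPred_eq]
    rw [Fin.sum_univ_succAbove _ i]
    simp only [Fin.insertNth_apply_same, Fin.insertNth_apply_succAbove]
    have h3 : ((p ^ n : ℕ) : ℤ) ∣ x w ^ k - (N - ∑ l, y w l ^ k) := by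
      push_cast; exact hx w
    rw [← ZMod.intCast_zmod_eq_zero_iff_dvd] at h3
    push_cast at h3
    linear_combination h3
  · intro w _ w' _ h
    funext l
    have h4 := congrFun h (i.succAbove l)
    simp only [Fin.insertNth_apply_succAbove] at h4
    rw [← sub_eq_zero, ← Int.cast_sub, ZMod.intCast_zmod_eq_zero_iff_dvd] at h4
    simp only [y, add_sub_add_left_eq_sub, ← mul_sub] at h4
    have h5 : ((p ^ (n - γ) : ℕ) : ℤ) ∣ ((w l).val : ℤ) - (w' l).val := by
      push_cast at h4 ⊢
      rcases le_total n γ with hn | hn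
      · simp [Nat.sub_eq_zero_of_le hn]
      · have h6 : (p : ℤ) ^ n = p ^ γ * p ^ (n - γ) := by rw [← pow_add, Nat.add_sub_cancel' hn]
        rw [h6] at h4
        simpa using (mul_dvd_mul_iff_left (pow_ne_zero γ hp0)).1 h4
    rw [← ZMod.intCast_zmod_eq_zero_iff_dvd, Int.cast_sub, sub_eq_zero] at h5
    simpa using h5

lemma exists_pow_le_density_prime_pow {p k : ℕ} (hp : p.Prime) (hk : 2 ≤ k) :
    ∃ c : ℝ, 0 < c ∧ c ≤ 1 ∧ ∀ d, 2 ^ k + 1 ≤ d → ∀ N n, c ^ d ≤ density k d N (p ^ n) := by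
  obtain ⟨γ, hlift, hsol⟩ := exists_liftsFrom_and_hasPrimitiveSol hp hk
  have hp1 : (1 : ℝ) ≤ p := by exact_mod_cast hp.one_le
  have hp0 : (0 : ℝ) < p := by linarith
  refine ⟨((p : ℝ) ^ γ)⁻¹, by positivity, inv_le_one_of_one_le₀ (one_le_pow₀ hp1),
    fun d hd N n => ?_⟩
  have : NeZero (p ^ n) := ⟨(pow_pos hp.pos _).ne'⟩
  have h1 : (p : ℝ) ^ ((n - γ) * (d - 1)) ≤ numSol k d N (p ^ n) := by
    exact_mod_cast pow_le_numSol hp hlift (hsol d hd N) n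
  have hpn : (0 : ℝ) < (p ^ n : ℕ) := by exact_mod_cast pow_pos hp.pos n
  rw [density_eq, inv_pow, inv_eq_one_div, div_le_div_iff₀ (by positivity) (by positivity), one_mul]
  have hexp : n * d ≤ n + (n - γ) * (d - 1) + γ * d := by
    obtain ⟨d, rfl⟩ := Nat.exists_eq_add_of_le' (show 1 ≤ d from (Nat.le_add_left 1 _).trans hd)
    have h2 : n ≤ (n - γ) + γ := by omega
    have h3 := Nat.mul_le_mul_right d h2
    rw [Nat.add_sub_cancel]
    nlinarith
  calc (((p ^ n : ℕ) : ℝ)) ^ d = (p : ℝ) ^ (n * d) := by push_cast; rw [pow_mul]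
    _ ≤ (p : ℝ) ^ (n + (n - γ) * (d - 1) + γ * d) := pow_le_pow_right₀ hp1 hexp
    _ = (p : ℝ) ^ n * (p : ℝ) ^ ((n - γ) * (d - 1)) * ((p : ℝ) ^ γ) ^ d := by
        rw [pow_add, pow_add, pow_mul (p : ℝ) γ]
    _ ≤ _ := by push_cast; gcongr

/-- The density at p^n is 1 plus the terms at p, ..., p^n, dominated by a geometric series of ratio
p^(-s) ≤ 1/2. -/
lemma one_sub_le_density_prime_pow {p k d N : ℕ} {K s : ℝ} (hp : p.Prime) (hs : 1 < s)
    (hb : ∀ q : ℕ, ‖singularTerm k d N q‖ ≤ K * (q : ℝ) ^ (-s)) (n : ℕ) :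
    1 - 2 * K * (p : ℝ) ^ (-s) ≤ density k d N (p ^ n) := by
  have hp2 : (2 : ℝ) ≤ p := by exact_mod_cast hp.two_le
  have hp0 : (0 : ℝ) < p := by linarith
  have hK : 0 ≤ K := by simpa using (norm_nonneg _).trans (hb 1)
  set x : ℝ := (p : ℝ) ^ (-s) with hx
  have hx0 : 0 ≤ x := by positivity
  have hx2 : x ≤ 1 / 2 := by
    calc x ≤ (p : ℝ) ^ (-1 : ℝ) := Real.rpow_le_rpow_of_exponent_le (by linarith) (by linarith)
      _ = 1 / p := by rw [Real.rpow_neg_one, one_div]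
      _ ≤ 1 / 2 := by gcongr
  have h1 : singularTerm k d N 1 = 1 := by
    simpa [density_one] using sum_divisors_singularTerm_eq_density k d N 1 one_ne_zero
  have h2 := sum_divisors_singularTerm_eq_density k d N (p ^ n) (pow_pos hp.pos n).ne'
  rw [Nat.sum_divisors_prime_pow hp, sum_range_succ', pow_zero, h1] at h2
  have h3 : ‖∑ h ∈ range n, singularTerm k d N (p ^ (h + 1))‖ ≤ 2 * K * x := by
    calc _ ≤ ∑ h ∈ range n, ‖singularTerm k d N (p ^ (h + 1))‖ := norm_sum_le _ _
      _ ≤ ∑ h ∈ range n, K * x * (1 / 2) ^ h := by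
          refine sum_le_sum fun h _ => (hb _).trans ?_
          have h4 : ((p ^ (h + 1) : ℕ) : ℝ) ^ (-s) = x * x ^ h := by
            rw [← pow_succ', hx]
            push_cast
            rw [← Real.rpow_natCast, ← Real.rpow_natCast, ← Real.rpow_mul hp0.le,
              ← Real.rpow_mul hp0.le, mul_comm]
          rw [h4, ← mul_assoc]
          gcongr
      _ = K * x * ∑ h ∈ range n, (1 / 2 : ℝ) ^ h := by rw [mul_sum]
      _ ≤ K * x * 2 := by gcongr; exact sum_geometric_two_le n
      _ = _ := by ring
  have h5 : ‖∑ h ∈ range n, singularTerm k d N (p ^ (h + 1))‖ = |density k d N (p ^ n) - 1| := by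
    rw [← Real.norm_eq_abs, ← Complex.norm_real]; push_cast; rw [← h2, add_sub_cancel_right]
  rw [h5] at h3
  linarith [(abs_le.1 h3).1]

/-- The Weierstrass product inequality. -/
lemma one_sub_sum_le_prod {ι : Type*} (t : Finset ι) (b f : ι → ℝ)
    (hb0 : ∀ i ∈ t, 0 ≤ b i) (hb1 : ∑ i ∈ t, b i ≤ 1) (hf : ∀ i ∈ t, 1 - b i ≤ f i) :
    1 - ∑ i ∈ t, b i ≤ ∏ i ∈ t, f i := by
  classical
  induction t using Finset.induction_on with
  | empty => simp
  | insert i t hi ih =>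
    rw [sum_insert hi] at hb1
    rw [sum_insert hi, prod_insert hi]
    simp only [mem_insert, forall_eq_or_imp] at hb0 hf
    have h0 : 0 ≤ ∑ i ∈ t, b i := sum_nonneg hb0.2
    have h1 := ih hb0.2 (by linarith) hf.2
    calc 1 - (b i + ∑ i ∈ t, b i) ≤ (1 - b i) * (1 - ∑ i ∈ t, b i) := by
          nlinarith [mul_nonneg hb0.1 h0]
      _ ≤ f i * ∏ i ∈ t, f i :=
          mul_le_mul hf.1 h1 (by linarith) (by linarith [hf.1])

lemma exists_pow_le_density {k : ℕ} (hk : 2 ≤ k) {K s : ℝ} (hs : 1 < s)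
    (hb : ∀ d, 2 ^ k + 1 ≤ d → ∀ N q, ‖singularTerm k d N q‖ ≤ K * (q : ℝ) ^ (-s)) :
    ∃ a : ℝ, 0 < a ∧ ∀ d, 2 ^ k + 1 ≤ d → ∀ N Q, Q ≠ 0 → a ^ d ≤ density k d N Q := by
  have hK : 0 ≤ K := by simpa using (norm_nonneg _).trans (hb _ le_rfl 0 1)
  choose! c hc0 hc1 hc using fun (p : ℕ) (hp : p.Prime) =>
    exists_pow_le_density_prime_pow (k := k) hp hk
  have hsum : Summable fun n : ℕ => 2 * K * (n : ℝ) ^ (-s) :=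
    (Real.summable_nat_rpow.2 (by linarith)).mul_left _
  -- The exceptional set depends only on K and s, so it serves all d, N and Q at once.
  obtain ⟨S, hS⟩ := summable_iff_vanishing_norm.1 hsum (1 / 2) (by norm_num)
  have hprod0 : 0 < ∏ p ∈ S with Nat.Prime p, c p :=
    prod_pos fun p hp => hc0 p (mem_filter.1 hp).2
  refine ⟨1 / 2 * ∏ p ∈ S with Nat.Prime p, c p, by positivity, fun d hd N Q hQ => ?_⟩
  rw [density_eq_prod k d N Q hQ,
    ← prod_filter_mul_prod_filter_not Q.primeFactors (fun p => p ∈ S), mul_pow, mul_comm]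
  have hsmall : (∏ p ∈ S with Nat.Prime p, c p) ^ d ≤
      ∏ p ∈ Q.primeFactors with p ∈ S, density k d N (p ^ Q.factorization p) := by
    calc (∏ p ∈ S with Nat.Prime p, c p) ^ d = ∏ p ∈ S with Nat.Prime p, c p ^ d := (prod_pow _ _ _).symm
      -- Primes of S not dividing Q may be dropped because c p ≤ 1.
      _ ≤ ∏ p ∈ Q.primeFactors with p ∈ S, c p ^ d := by
          refine prod_le_prod_of_subset_of_le_one (fun p hp => ?_) (fun p hp => ?_)
            fun p hp _ => ?_
          · rw [mem_filter] at hp ⊢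
            exact ⟨hp.2, Nat.prime_of_mem_primeFactors hp.1⟩
          · have := hc0 p (mem_filter.1 hp).2; positivity
          · have hp' := (mem_filter.1 hp).2
            exact pow_le_one₀ (hc0 p hp').le (hc1 p hp')
      _ ≤ _ := by
          refine prod_le_prod (fun p hp => ?_) fun p hp => ?_
          · have := hc0 p (Nat.prime_of_mem_primeFactors (mem_filter.1 hp).1); positivity
          · exact hc p (Nat.prime_of_mem_primeFactors (mem_filter.1 hp).1) d hd N _
  have hlarge : (1 / 2 : ℝ) ^ d ≤
      ∏ p ∈ Q.primeFactors with p ∉ S, density k d N (p ^ Q.factorization p) := by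
    have h1 := hS {p ∈ Q.primeFactors | p ∉ S}
      (disjoint_left.2 fun p hp => (mem_filter.1 hp).2)
    have h2 := (le_abs_self _).trans_lt h1
    refine le_trans ?_ (one_sub_sum_le_prod _ (fun p : ℕ => 2 * K * (p : ℝ) ^ (-s)) _ ?_ ?_ ?_)
    · calc (1 / 2 : ℝ) ^ d ≤ (1 / 2) ^ 1 :=
            pow_le_pow_of_le_one (by norm_num) (by norm_num) ((Nat.le_add_left 1 _).trans hd)
        _ ≤ _ := by linarith
    · intro p _; positivity
    · linarith
    · intro p hp
      exact one_sub_le_density_prime_pow (Nat.prime_of_mem_primeFactors (mem_filter.1 hp).1) hs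
        (hb d hd N) _
  exact mul_le_mul hsmall hlarge (by positivity) ((by positivity : (0 : ℝ) ≤ _).trans hsmall)

end Waring

/-! ### The limit along factorials -/

open Waring in
theorem mainTheorem3 (k : ℕ) (hk : 2 ≤ k) :
    ∃ a A : ℝ, 0 < a ∧ 0 < A ∧
      ∀ d : ℕ, 2 ^ k + 1 ≤ d → ∀ N : ℕ, 1 ≤ N →
        Summable (Waring.singularTerm k d N) ∧
        (Waring.singularSeries k d N).im = 0 ∧
        a ^ d ≤ (Waring.singularSeries k d N).re ∧
        (Waring.singularSeries k d N).re ≤ A := by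
  obtain ⟨K, s, hK, hs, hb⟩ := exists_norm_singularTerm_le hk
  obtain ⟨a, ha, hdens⟩ := exists_pow_le_density hk hs hb
  have hsum : Summable fun q : ℕ => K * (q : ℝ) ^ (-s) :=
    (Real.summable_nat_rpow.2 (by linarith)).mul_left _
  refine ⟨a, ∑' q : ℕ, K * (q : ℝ) ^ (-s) + 1, ha, ?_, fun d hd N _ => ?_⟩
  · have : 0 ≤ ∑' q : ℕ, K * (q : ℝ) ^ (-s) := tsum_nonneg fun q => by positivity
    linarith
  have hS : Summable (singularTerm k d N) := Summable.of_norm_bounded hsum (hb d hd N)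
  have hlim : Filter.Tendsto (fun n : ℕ => (density k d N n.factorial : ℂ)) Filter.atTop
      (nhds (singularSeries k d N)) := by
    -- The divisors of n! miss only q = 0 in the limit; it is inserted so that the sets exhaust ℕ,
    -- and its term vanishes.
    have hmono : Filter.Tendsto (fun n : ℕ => insert 0 n.factorial.divisors) Filter.atTop
        Filter.atTop := by
      refine Filter.tendsto_atTop_finset_of_monotone (fun m n hmn => ?_) fun q => ⟨q, ?_⟩
      · exact Finset.insert_subset_insert _
          (Nat.divisors_subset_of_dvd n.factorial_ne_zero (Nat.factorial_dvd_factorial hmn))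
      · rcases Nat.eq_zero_or_pos q with rfl | hq
        · simp
        · exact Finset.mem_insert_of_mem
            (Nat.mem_divisors.2 ⟨Nat.dvd_factorial hq le_rfl, q.factorial_ne_zero⟩)
    refine (hS.hasSum.comp hmono).congr fun n => ?_
    rw [Function.comp_apply, Finset.sum_insert (by simp), singularTerm_zero, zero_add,
      sum_divisors_singularTerm_eq_density k d N _ n.factorial_ne_zero]
  refine ⟨hS, ?_, ?_, ?_⟩
  · have := (Complex.continuous_im.tendsto _).comp hlim
    simp only [Function.comp_def, Complex.ofReal_im] at this
    exact tendsto_nhds_unique this tendsto_const_nhds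
  · have := (Complex.continuous_re.tendsto _).comp hlim
    simp only [Function.comp_def, Complex.ofReal_re] at this
    exact ge_of_tendsto' this fun n => hdens d hd N _ n.factorial_ne_zero
  · calc (singularSeries k d N).re ≤ ‖singularSeries k d N‖ := Complex.re_le_norm _
      _ ≤ ∑' q : ℕ, K * (q : ℝ) ^ (-s) := tsum_of_norm_bounded hsum.hasSum (hb d hd N)
      _ ≤ _ := by linarith
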